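/- Let $d \ge 1$, let $\mathbb{T}^d = \mathbb{R}^d/\mathbb{Z}^d$ be the $d$-dimensional torus with the metric $\operatorname{dist}$ induced by the Euclidean metric of $\mathbb{R}^d$, and let $B(x,r) = \{y \in \mathbb{T}^d : \operatorname{dist}(x,y) < r\}$ be the open ball (empty if $r = 0$). Let $\mu$ be the Lebesgue (normalised Haar) measure on $\mathbb{T}^d$. Let $A$ be a $d \times d$ integer matrix none of whose complex eigenvalues is a root of unity, and let $T \colon \mathbb{T}^d \to \mathbb{T}^d$, $T(x) = Ax \bmod 1$. Let $(r_n)_{n \ge 1}$ be a sequence of non-negative real numbers, and let $$R_{\mathrm{io}}(r_n) = \{x \in \mathbb{T}^d : T^n(x) \in B(x, r_n) \text{ for infinitely many } n \ge 1\}.$$ Then $$\sum_{n=1}^\infty r_n^d < \infty \implies \mu(R_{\mathrm{io}}(r_n)) = 0.$$ Moreover, if all complex eigenvalues $\lambda$ of $A$ satisfy $|\lambda| > 1$, then $$\sum_{n=1}^\infty r_n^d = \infty \implies \mu(R_{\mathrm{io}}(r_n)) = 1.$$ -/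

import Mathlib

open MeasureTheory

noncomputable section

/-- The endomorphism `x ↦ A x mod 1` of the torus `𝕋ᵈ = (ℝ / ℤ)ᵈ` induced by an integer matrix `A`. -/
def torusEndo {d : ℕ} (A : Matrix (Fin d) (Fin d) ℤ) (x : UnitAddTorus (Fin d)) :
    UnitAddTorus (Fin d) :=
  fun i => ∑ j, A i j • x j

/-- The Euclidean (flat) distance on the torus `(ℝ / ℤ)ᵈ`. The norm of `ℝ / ℤ` is the distance to
the nearest integer, so this is the minimum over `k ∈ ℤᵈ` of the Euclidean length of `x - y - k`. -/
def torusDist {d : ℕ} (x y : UnitAddTorus (Fin d)) : ℝ :=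
  Real.sqrt (∑ i, ‖x i - y i‖ ^ 2)

/-- The open ball of centre `x` and radius `r` in the torus; it is empty when `r = 0`. -/
def torusBall {d : ℕ} (x : UnitAddTorus (Fin d)) (r : ℝ) : Set (UnitAddTorus (Fin d)) :=
  {y | torusDist y x < r}

/-- The set of points `x` such that `Tⁿ x ∈ B(x, rₙ)` for infinitely many `n ≥ 1`. -/
def returnsInfinitelyOften {d : ℕ} (T : UnitAddTorus (Fin d) → UnitAddTorus (Fin d))
    (r : ℕ → ℝ) : Set (UnitAddTorus (Fin d)) :=
  {x | {n : ℕ | 1 ≤ n ∧ T^[n] x ∈ torusBall x (r n)}.Infinite}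

/-- `z` is a complex eigenvalue of the integer matrix `A`. -/
def IsComplexEigenvalue {d : ℕ} (A : Matrix (Fin d) (Fin d) ℤ) (z : ℂ) : Prop :=
  Module.End.HasEigenvalue (Matrix.toLin' (A.map (Int.cast : ℤ → ℂ))) z

end

/-!
# Borel–Cantelli dichotomy for the return times of toral endomorphisms

Put `Sₙ = Aⁿ - 1`, so that `Tⁿ x - x = Sₙ x` and the event `Tⁿ x ∈ B(x, rₙ)` says that `Sₙ x` lies in
the ball `B(0, rₙ)`. Since no eigenvalue of `A` is a root of unity, `det Sₙ ≠ 0`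
(`det_pow_sub_one_ne_zero`), hence `Sₙ` induces a surjective endomorphism of the torus, which
preserves Haar measure (`measurePreserving_torusEndo`). The `n`-th event therefore has measure
`μ(B(0, rₙ))`, at most a constant times `rₙᵈ`, and the convergence half is the first Borel–Cantelli
lemma.

For the divergence half, replace the balls by inscribed cubes `Qₙ`, that is, balls for the sup
metric, and let `Eₙ = Sₙ⁻¹ Qₙ`. The heart of the proof is a correlation bound
(`volume_inter_preimage_ball_le`). Let `m < n` and `δ = ‖Sₘ Sₙ⁻¹‖`. Translating a point `x` by
`Sₙ⁻¹ v`, with `v` in the unit cube of `ℝᵈ`, moves `Sₘ x` by at most `δ` while `Sₙ x` moves by `v`;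
averaging over `v` makes the second condition independent of the first, so
`μ(Eₘ ∩ Eₙ) ≤ μ(Qₘ enlarged by δ) μ(Qₙ)`. When all eigenvalues have modulus greater than `1`,
Gelfand's formula for `A⁻¹` bounds `δ` by a summable function of `n - m`
(`exists_summable_bound_pow_sub_one_mul_inv`), so that `μ(Eₘ ∩ Eₙ) ≤ μ(Eₙ) (μ(Eₘ) + c(n - m))`
with `c` summable. The variance of the number of events among the first `N` is then at most a
constant times its mean, and Chebyshev's inequality gives full measure
(`measure_infinite_eq_one_of_correlation_le`). No zero-one law is required, because the main term of
the correlations carries the constant `1`.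
-/

/-! ### Integer matrices acting on the torus -/

section TorusEndo

variable {d : ℕ}

theorem torusEndo_mul (M N : Matrix (Fin d) (Fin d) ℤ) (x : UnitAddTorus (Fin d)) :
    torusEndo (M * N) x = torusEndo M (torusEndo N x) := by
  funext i
  simp only [torusEndo, Matrix.mul_apply, Finset.sum_smul, Finset.smul_sum, mul_smul]
  exact Finset.sum_comm

theorem torusEndo_one (x : UnitAddTorus (Fin d)) :
    torusEndo (1 : Matrix (Fin d) (Fin d) ℤ) x = x := by
  funext i
  simp [torusEndo, Matrix.one_apply]

theorem torusEndo_sub (M N : Matrix (Fin d) (Fin d) ℤ) (x : UnitAddTorus (Fin d)) :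
    torusEndo (M - N) x = torusEndo M x - torusEndo N x := by
  funext i
  simp [torusEndo, sub_smul]

theorem torusEndo_add_right (M : Matrix (Fin d) (Fin d) ℤ) (x y : UnitAddTorus (Fin d)) :
    torusEndo M (x + y) = torusEndo M x + torusEndo M y := by
  funext i
  simp [torusEndo, Finset.sum_add_distrib]

theorem torusEndo_iterate (A : Matrix (Fin d) (Fin d) ℤ) (n : ℕ) (x : UnitAddTorus (Fin d)) :
    (torusEndo A)^[n] x = torusEndo (A ^ n) x := by
  induction n with
  | zero => simp [torusEndo_one]
  | succ n ih => rw [Function.iterate_succ_apply', ih, pow_succ', torusEndo_mul]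

theorem continuous_torusEndo (M : Matrix (Fin d) (Fin d) ℤ) : Continuous (torusEndo M) := by
  unfold torusEndo
  fun_prop

/-- The covering map `ℝᵈ → 𝕋ᵈ`. -/
def torusMk (v : Fin d → ℝ) : UnitAddTorus (Fin d) := fun i => (v i : UnitAddCircle)

theorem torusEndo_torusMk (M : Matrix (Fin d) (Fin d) ℤ) (v : Fin d → ℝ) :
    torusEndo M (torusMk v) = torusMk ((M.map (Int.cast : ℤ → ℝ)).mulVec v) := by
  funext i
  have h (j : Fin d) : ((M i j * v j : ℝ) : UnitAddCircle) = M i j • (v j : UnitAddCircle) := by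
    rw [← zsmul_eq_mul, AddCircle.coe_zsmul]
  simp only [torusEndo, torusMk, Matrix.mulVec, dotProduct, Matrix.map_apply, ← h]
  exact (map_sum (QuotientAddGroup.mk' (AddSubgroup.zmultiples (1 : ℝ)))
    (fun j => (M i j * v j : ℝ)) Finset.univ).symm

theorem exists_torusMk_eq (w : UnitAddTorus (Fin d)) :
    ∃ v : Fin d → ℝ, (∀ i, |v i| ≤ 1) ∧ torusMk v = w := by
  have h (i : Fin d) : ∃ t : ℝ, |t| ≤ 1 ∧ (t : UnitAddCircle) = w i := by
    obtain ⟨t, ht, htw⟩ : w i ∈ ((↑) : ℝ → UnitAddCircle) '' Set.Ico 0 (0 + 1) := by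
      rw [AddCircle.coe_image_Ico_eq]
      trivial
    exact ⟨t, abs_le.2 ⟨by linarith [ht.1], by linarith [ht.2]⟩, htw⟩
  choose v hv using h
  exact ⟨v, fun i => (hv i).1, funext fun i => (hv i).2⟩

theorem isUnit_det_map_intCast {M : Matrix (Fin d) (Fin d) ℤ} (hM : M.det ≠ 0)
    (K : Type*) [Field K] [CharZero K] : IsUnit (M.map (Int.cast : ℤ → K)).det := by
  have h : (M.map (Int.cast : ℤ → K)).det = (M.det : K) :=
    ((Int.castRingHom K).map_det M).symm
  rw [h, isUnit_iff_ne_zero]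
  exact_mod_cast hM

/-- A nonsingular integer matrix induces a surjective endomorphism of a compact group, and such an
endomorphism preserves Haar measure. -/
theorem measurePreserving_torusEndo {M : Matrix (Fin d) (Fin d) ℤ} (hM : M.det ≠ 0) :
    MeasurePreserving (torusEndo M) := by
  let f : UnitAddTorus (Fin d) →+ UnitAddTorus (Fin d) :=
    AddMonoidHom.mk' (torusEndo M) (torusEndo_add_right M)
  refine AddMonoidHom.measurePreserving (f := f) (continuous_torusEndo M) (fun w => ?_) rfl
  obtain ⟨v, -, rfl⟩ := exists_torusMk_eq w
  refine ⟨torusMk ((M.map (Int.cast : ℤ → ℝ))⁻¹.mulVec v), ?_⟩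
  change torusEndo M _ = _
  rw [torusEndo_torusMk, Matrix.mulVec_mulVec,
    Matrix.mul_nonsing_inv _ (isUnit_det_map_intCast hM ℝ), Matrix.one_mulVec]

theorem norm_torusMk_le {v : Fin d → ℝ} {δ : ℝ} (hδ : 0 ≤ δ) (hv : ∀ i, |v i| ≤ δ) :
    ‖torusMk v‖ ≤ δ := by
  refine (pi_norm_le_iff_of_nonneg hδ).2 fun i => ?_
  exact (QuotientAddGroup.norm_mk_le_norm (S := AddSubgroup.zmultiples (1 : ℝ))).trans (hv i)

instance isProbabilityMeasure_volume_unitAddTorus :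
    IsProbabilityMeasure (volume : Measure (UnitAddTorus (Fin d))) :=
  have : IsProbabilityMeasure (volume : Measure UnitAddCircle) := ⟨UnitAddCircle.measure_univ⟩
  inferInstanceAs (IsProbabilityMeasure (Measure.pi fun _ => volume))

/-- Balls for the sup metric on the torus are cubes, whose volume is explicit even when the side
exceeds the period. The condition `1 ≤ d` is needed for the empty ball of radius `0`. -/
theorem volume_ball_unitAddTorus (hd : 1 ≤ d) (x : UnitAddTorus (Fin d)) {s : ℝ} (hs : 0 ≤ s) :
    volume (Metric.ball x s) = ENNReal.ofReal (min 1 (2 * s) ^ d) := by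
  rcases hs.eq_or_lt with rfl | hs'
  · simp [Nat.one_le_iff_ne_zero.1 hd]
  · rw [ball_pi x hs', volume_pi_pi]
    simp only [← measure_congr AddCircle.closedBall_ae_eq_ball, AddCircle.volume_closedBall,
      Finset.prod_const, Finset.card_univ, Fintype.card_fin]
    rw [ENNReal.ofReal_pow (le_min zero_le_one (by positivity))]

theorem torusEndo_iterate_sub (A : Matrix (Fin d) (Fin d) ℤ) (n : ℕ) (x : UnitAddTorus (Fin d)) :
    (torusEndo A)^[n] x - x = torusEndo (A ^ n - 1) x := by
  rw [torusEndo_iterate, torusEndo_sub, torusEndo_one]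

end TorusEndo

/-! ### Correlation of two cube preimages -/

/-- For `x` in the intersection and a vector `v` of the unit cube, `x' = x + N⁻¹ v` satisfies
`N x' = N x + v`, whereas `M x'` stays within `δ` of `M x`. As `v` ranges over the unit cube, the
point `N x + v` is equidistributed, whence the product bound. -/
theorem volume_inter_preimage_ball_le {d : ℕ} {M N : Matrix (Fin d) (Fin d) ℤ}
    (hM : M.det ≠ 0) (hN : N.det ≠ 0) {δ : ℝ} (hδ : 0 ≤ δ)
    (h : ∀ v : Fin d → ℝ, (∀ i, |v i| ≤ 1) →
      ∀ i, |(M.map (Int.cast : ℤ → ℝ) * (N.map (Int.cast : ℤ → ℝ))⁻¹).mulVec v i| ≤ δ)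
    (s t : ℝ) :
    volume (torusEndo M ⁻¹' Metric.ball 0 s ∩ torusEndo N ⁻¹' Metric.ball 0 t) ≤
      volume (Metric.ball (0 : UnitAddTorus (Fin d)) (s + δ)) *
        volume (Metric.ball (0 : UnitAddTorus (Fin d)) t) := by
  set U := torusEndo M ⁻¹' Metric.ball 0 s ∩ torusEndo N ⁻¹' Metric.ball 0 t
  -- the fibre of `P` over `w` contains the translate of `U` by `N⁻¹ v`, where `v` lifts `w`
  let P : Set (UnitAddTorus (Fin d) × UnitAddTorus (Fin d)) :=
    {p | torusEndo M p.2 ∈ Metric.ball 0 (s + δ) ∧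
      torusEndo N p.2 - p.1 ∈ Metric.ball 0 t}
  have hP : MeasurableSet P := by
    refine IsOpen.measurableSet (IsOpen.inter ?_ ?_)
    · exact Metric.isOpen_ball.preimage ((continuous_torusEndo M).comp continuous_snd)
    · exact Metric.isOpen_ball.preimage
        (((continuous_torusEndo N).comp continuous_snd).sub continuous_fst)
  have hle (w : UnitAddTorus (Fin d)) : volume U ≤ volume (Prod.mk w ⁻¹' P) := by
    obtain ⟨v, hv, rfl⟩ := exists_torusMk_eq w
    set u : UnitAddTorus (Fin d) := torusMk ((N.map (Int.cast : ℤ → ℝ))⁻¹.mulVec v)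
    have hNu : torusEndo N u = torusMk v := by
      rw [torusEndo_torusMk, Matrix.mulVec_mulVec,
        Matrix.mul_nonsing_inv _ (isUnit_det_map_intCast hN ℝ), Matrix.one_mulVec]
    have hMu : ‖torusEndo M u‖ ≤ δ := by
      rw [torusEndo_torusMk, Matrix.mulVec_mulVec]
      exact norm_torusMk_le hδ (h v hv)
    rw [← measure_preimage_add_right volume u (Prod.mk (torusMk v) ⁻¹' P)]
    refine measure_mono fun x hx => ?_
    simp only [U, Set.mem_inter_iff, Set.mem_preimage, mem_ball_zero_iff] at hx
    simp only [P, Set.mem_preimage, Set.mem_ofPred_eq, mem_ball_zero_iff,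
      torusEndo_add_right, hNu, add_sub_cancel_right]
    exact ⟨(norm_add_le _ _).trans_lt (add_lt_add_of_lt_of_le hx.1 hMu), hx.2⟩
  calc volume U = ∫⁻ _ : UnitAddTorus (Fin d), volume U := by simp
    _ ≤ ∫⁻ w : UnitAddTorus (Fin d), volume (Prod.mk w ⁻¹' P) := lintegral_mono hle
    _ = (volume.prod volume) P := (Measure.prod_apply hP).symm
    _ = ∫⁻ x : UnitAddTorus (Fin d), volume ((fun w => (w, x)) ⁻¹' P) :=
        Measure.prod_apply_symm hP
    _ = ∫⁻ x : UnitAddTorus (Fin d),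
          (torusEndo M ⁻¹' Metric.ball 0 (s + δ)).indicator
            (fun _ => volume (Metric.ball (0 : UnitAddTorus (Fin d)) t)) x := by
        refine lintegral_congr fun x => ?_
        by_cases hx : x ∈ torusEndo M ⁻¹' Metric.ball 0 (s + δ)
        · rw [Set.indicator_of_mem hx,
            ← Measure.addHaar_ball_center volume (torusEndo N x) t]
          congr 1
          ext w
          rw [Set.mem_preimage] at hx
          simp only [P, Set.mem_preimage, Set.mem_ofPred_eq, hx, true_and]
          rw [mem_ball_zero_iff, mem_ball_iff_norm']
        · rw [Set.indicator_of_notMem hx]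
          refine (congrArg volume ?_).trans measure_empty
          ext w
          rw [Set.mem_preimage] at hx
          simp only [P, Set.mem_preimage, Set.mem_ofPred_eq, hx, false_and, Set.mem_empty_iff_false]
    _ = _ := by
        have hS : MeasurableSet (Metric.ball (0 : UnitAddTorus (Fin d)) (s + δ)) :=
          Metric.isOpen_ball.measurableSet
        rw [lintegral_indicator_const ((continuous_torusEndo M).measurable hS),
          (measurePreserving_torusEndo hM).measure_preimage hS.nullMeasurableSet, mul_comm]

/-! ### Consequences of the eigenvalue conditions -/

section MatrixNorm

attribute [local instance] Matrix.linftyOpNormedRing Matrix.linftyOpNormedAlgebra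

theorem isComplexEigenvalue_iff_mem_spectrum {d : ℕ} (A : Matrix (Fin d) (Fin d) ℤ) (z : ℂ) :
    IsComplexEigenvalue A z ↔ z ∈ spectrum ℂ (A.map (Int.cast : ℤ → ℂ)) := by
  rw [IsComplexEigenvalue, Module.End.hasEigenvalue_iff_mem_spectrum, Matrix.spectrum_toLin']

/-- If `1` were an eigenvalue of `Aⁿ`, the spectral mapping theorem would give an eigenvalue `z` of
`A` with `zⁿ = 1`. -/
theorem det_pow_sub_one_ne_zero {d : ℕ} {A : Matrix (Fin d) (Fin d) ℤ} {n : ℕ} (hn : 1 ≤ n)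
    (hA : ∀ z : ℂ, IsComplexEigenvalue A z → z ^ n ≠ 1) : (A ^ n - 1).det ≠ 0 := by
  intro h
  have h1 : (1 : ℂ) ∈ spectrum ℂ (A.map (Int.cast : ℤ → ℂ) ^ n) := by
    rw [spectrum.mem_iff, ← neg_sub, IsUnit.neg_iff, Matrix.isUnit_iff_isUnit_det]
    have e : A.map (Int.cast : ℤ → ℂ) ^ n - algebraMap ℂ (Matrix (Fin d) (Fin d) ℂ) 1 =
        (Int.castRingHom ℂ).mapMatrix (A ^ n - 1) := by
      rw [map_sub, map_pow, map_one, map_one]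
      rfl
    rw [e, ← RingHom.map_det, h]
    simp
  rw [spectrum.map_pow_of_pos _ hn] at h1
  obtain ⟨z, hz, hz1⟩ := h1
  exact hA z ((isComplexEigenvalue_iff_mem_spectrum A z).2 hz) hz1

/-- By Gelfand's formula, `‖bⁿ‖` is eventually bounded by a geometric sequence. -/
theorem summable_norm_pow_of_spectralRadius_lt_one {B : Type*} [NormedRing B] [NormedAlgebra ℂ B]
    [CompleteSpace B] {b : B} (hb : spectralRadius ℂ b < 1) : Summable fun n : ℕ => ‖b ^ n‖ := by
  obtain ⟨ρ, hbρ, hρ⟩ := ENNReal.lt_iff_exists_nnreal_btwn.1 hb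
  have hev := (spectrum.pow_nnnorm_pow_one_div_tendsto_nhds_spectralRadius b).eventually_lt_const hbρ
  have hρ1 : (ρ : ℝ) < 1 := by exact_mod_cast hρ
  refine Summable.of_norm_bounded_eventually_nat
    (summable_geometric_of_lt_one ρ.coe_nonneg hρ1) ?_
  filter_upwards [hev, Filter.eventually_gt_atTop 0] with n hn hn0
  have h2 := ENNReal.rpow_le_rpow hn.le (Nat.cast_nonneg (α := ℝ) n)
  rw [← ENNReal.rpow_mul, one_div, inv_mul_cancel₀ (by positivity), ENNReal.rpow_one,
    ENNReal.rpow_natCast] at h2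
  rw [norm_norm]
  exact_mod_cast h2

theorem spectralRadius_inv_lt_one {d : ℕ} (hd : 1 ≤ d) {A : Matrix (Fin d) (Fin d) ℤ}
    (hA : ∀ z : ℂ, IsComplexEigenvalue A z → 1 < ‖z‖) :
    IsUnit (A.map (Int.cast : ℤ → ℂ)) ∧ spectralRadius ℂ (A.map (Int.cast : ℤ → ℂ))⁻¹ < 1 := by
  have : Nonempty (Fin d) := ⟨⟨0, hd⟩⟩
  have hu : IsUnit (A.map (Int.cast : ℤ → ℂ)) := by
    by_contra h
    -- a singular `A` would have the eigenvalue `0`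
    have h0 := hA 0 ((isComplexEigenvalue_iff_mem_spectrum A 0).2 ((spectrum.zero_mem_iff ℂ).2 h))
    simp at h0
    linarith
  refine ⟨hu, ?_⟩
  obtain ⟨u, hu⟩ := hu
  refine spectrum.spectralRadius_lt_of_forall_lt (r := 1) _ fun z hz => ?_
  rw [← hu, ← Matrix.coe_units_inv, ← spectrum.map_inv, Set.mem_inv, hu,
    ← isComplexEigenvalue_iff_mem_spectrum] at hz
  have h1 := hA _ hz
  rw [norm_inv] at h1
  have : ‖z‖ < 1 := by
    by_contra! h
    exact absurd h1 (not_lt.2 (inv_le_one_of_one_le₀ h))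
  exact_mod_cast this

/-- If `(bⁿ)` is summable, `(1 - bⁿ)⁻¹` converges to `1`, hence is bounded. -/
theorem exists_norm_one_sub_pow_mul_le {R : Type*} [NormedRing R] [CompleteSpace R] {b : R}
    (hb : Summable fun n : ℕ => ‖b ^ n‖) :
    ∃ C : ℝ, 0 ≤ C ∧ ∀ m n : ℕ, ‖(1 - b ^ m) * Ring.inverse (1 - b ^ n)‖ ≤ C := by
  have h0 : Filter.Tendsto (fun n : ℕ => b ^ n) Filter.atTop (nhds 0) :=
    tendsto_zero_iff_norm_tendsto_zero.2 hb.tendsto_atTop_zero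
  have h1 : Filter.Tendsto (fun n : ℕ => 1 - b ^ n) Filter.atTop (nhds 1) := by
    simpa using h0.const_sub 1
  have h2 : Filter.Tendsto (fun n : ℕ => Ring.inverse (1 - b ^ n)) Filter.atTop (nhds 1) := by
    have := (NormedRing.inverse_continuousAt (1 : Rˣ)).tendsto.comp h1
    simpa [Function.comp_def] using this
  obtain ⟨C₁, hC₁⟩ := h1.norm.bddAbove_range
  obtain ⟨C₂, hC₂⟩ := h2.norm.bddAbove_range
  have hC₁' (n : ℕ) := hC₁ (Set.mem_range_self n)
  have hC₂' (n : ℕ) := hC₂ (Set.mem_range_self n)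
  have hC0 : 0 ≤ C₁ := (norm_nonneg _).trans (hC₁' 0)
  have hC0' : 0 ≤ C₂ := (norm_nonneg _).trans (hC₂' 0)
  exact ⟨C₁ * C₂, by positivity, fun m n => (norm_mul_le (1 - b ^ m) _).trans
    (mul_le_mul (hC₁' m) (hC₂' n) (norm_nonneg _) hC0)⟩

/-- The sup norm of `P v` is at most that of `v` times the largest absolute row sum of `P`, which is
the operator norm in force here; the norm is taken over `ℂ` because Gelfand's formula lives there. -/
theorem abs_mulVec_le_norm_map {d : ℕ} (P : Matrix (Fin d) (Fin d) ℝ) {v : Fin d → ℝ}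
    (hv : ∀ i, |v i| ≤ 1) (i : Fin d) : |P.mulVec v i| ≤ ‖P.map ((↑) : ℝ → ℂ)‖ := by
  have h1 : |P.mulVec v i| ≤ ∑ j, ‖P.map ((↑) : ℝ → ℂ) i j‖ := by
    refine (Finset.abs_sum_le_sum_abs (fun j => P i j * v j) Finset.univ).trans
      (Finset.sum_le_sum fun j _ => ?_)
    rw [abs_mul, Matrix.map_apply, Complex.norm_real, Real.norm_eq_abs]
    exact mul_le_of_le_one_right (abs_nonneg _) (hv j)
  refine h1.trans ?_
  rw [Matrix.linfty_opNorm_def]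
  have := Finset.le_sup (f := fun i => ∑ j, ‖P.map ((↑) : ℝ → ℂ) i j‖₊) (Finset.mem_univ i)
  have h3 := NNReal.coe_le_coe.2 this
  push_cast at h3
  exact_mod_cast h3

/-- For an expanding matrix, `(Aᵐ - 1)(Aⁿ - 1)⁻¹ = A⁻⁽ⁿ⁻ᵐ⁾ (1 - A⁻ᵐ)(1 - A⁻ⁿ)⁻¹` is bounded by a
summable function of `n - m`. -/
theorem exists_summable_bound_pow_sub_one_mul_inv {d : ℕ} (hd : 1 ≤ d)
    {A : Matrix (Fin d) (Fin d) ℤ} (hA : ∀ z : ℂ, IsComplexEigenvalue A z → 1 < ‖z‖) :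
    ∃ δ : ℕ → ℝ, (∀ n, 0 ≤ δ n) ∧ Summable δ ∧ ∀ m n : ℕ, m < n → (A ^ n - 1).det ≠ 0 →
      ∀ v : Fin d → ℝ, (∀ i, |v i| ≤ 1) → ∀ i,
        |((A ^ m - 1).map (Int.cast : ℤ → ℝ) *
          ((A ^ n - 1).map (Int.cast : ℤ → ℝ))⁻¹).mulVec v i| ≤ δ (n - m) := by
  obtain ⟨hu, hB⟩ := spectralRadius_inv_lt_one hd hA
  set Ac := A.map (Int.cast : ℤ → ℂ)
  have hs := summable_norm_pow_of_spectralRadius_lt_one hB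
  obtain ⟨C, hC0, hC⟩ := exists_norm_one_sub_pow_mul_le hs
  have hdet := (Matrix.isUnit_iff_isUnit_det _).1 hu
  refine ⟨fun n => ‖Ac⁻¹ ^ n‖ * C, fun n => by positivity, hs.mul_right C, ?_⟩
  intro m n hmn hn v hv i
  refine (abs_mulVec_le_norm_map _ hv i).trans ?_
  have hmap (k : ℕ) : ((A ^ k - 1).map (Int.cast : ℤ → ℝ)).map ((↑) : ℝ → ℂ) = Ac ^ k - 1 := by
    have : ((A ^ k - 1).map (Int.cast : ℤ → ℝ)).map ((↑) : ℝ → ℂ) =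
        (Int.castRingHom ℂ).mapMatrix (A ^ k - 1) := by
      ext a b
      simp
    rw [this, map_sub, map_pow, map_one]
    rfl
  have hnR := isUnit_det_map_intCast hn ℝ
  have hnC : IsUnit (Ac ^ n - 1) := by
    rw [← hmap, Matrix.isUnit_iff_isUnit_det]
    have := hnR.map Complex.ofRealHom
    rwa [RingHom.map_det] at this
  set B := Ac⁻¹
  have hAB (k : ℕ) : Ac ^ k * B ^ k = 1 := by
    have hcomm : Commute Ac B :=
      (Matrix.mul_nonsing_inv _ hdet).trans (Matrix.nonsing_inv_mul _ hdet).symm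
    rw [← hcomm.mul_pow, Matrix.mul_nonsing_inv _ hdet, one_pow]
  have hBA (k : ℕ) : B ^ k * Ac ^ k = 1 := mul_eq_one_comm.1 (hAB k)
  have hfac : Ac ^ n - 1 = (1 - B ^ n) * Ac ^ n := by
    rw [sub_mul, one_mul, hBA]
  have hBn : IsUnit (1 - B ^ n) := by
    have h : 1 - B ^ n = (Ac ^ n - 1) * B ^ n := by
      rw [sub_mul, one_mul, hAB]
    rw [h]
    exact hnC.mul (IsUnit.of_mul_eq_one _ (hBA n))
  -- both sides become `Aᵐ - 1` after multiplication by the unit `Aⁿ - 1` on the right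
  have hkey : ((A ^ m - 1).map (Int.cast : ℤ → ℝ) *
      ((A ^ n - 1).map (Int.cast : ℤ → ℝ))⁻¹).map ((↑) : ℝ → ℂ) =
      B ^ (n - m) * ((1 - B ^ m) * Ring.inverse (1 - B ^ n)) := by
    refine hnC.mul_right_cancel ?_
    have hleft : ((A ^ m - 1).map (Int.cast : ℤ → ℝ) *
        ((A ^ n - 1).map (Int.cast : ℤ → ℝ))⁻¹).map ((↑) : ℝ → ℂ) * (Ac ^ n - 1) =
        Ac ^ m - 1 := by
      have h := congrArg Complex.ofRealHom.mapMatrix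
        (Matrix.nonsing_inv_mul_cancel_right _ ((A ^ m - 1).map (Int.cast : ℤ → ℝ)) hnR)
      rw [map_mul] at h
      rw [← hmap n, ← hmap m]
      exact h
    rw [hleft]
    calc Ac ^ m - 1 = (B ^ (n - m) - B ^ n) * Ac ^ n := by
          have h : Ac ^ n = Ac ^ (n - m) * Ac ^ m := by rw [← pow_add, Nat.sub_add_cancel hmn.le]
          rw [sub_mul, hBA]
          rw [h, ← mul_assoc, hBA, one_mul]
      _ = B ^ (n - m) * (1 - B ^ m) * Ac ^ n := by
          rw [mul_sub, mul_one, ← pow_add, Nat.sub_add_cancel hmn.le]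
      _ = B ^ (n - m) * ((1 - B ^ m) * Ring.inverse (1 - B ^ n)) * (Ac ^ n - 1) := by
          rw [hfac]
          simp only [mul_assoc]
          rw [Ring.inverse_mul_cancel_left _ _ hBn]
  rw [hkey]
  exact (norm_mul_le _ _).trans (mul_le_mul_of_nonneg_left (hC m n) (norm_nonneg _))

end MatrixNorm

/-! ### The second moment method -/

open Classical in
/-- A divergence Borel–Cantelli lemma: if the events have divergent total measure and the excess
correlation of the `m`-th and `n`-th event is at most `μ (E n) * c (n - m)` with `c` summable, the
variance of the counting function is at most a constant times its mean, so that Chebyshev's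
inequality forces almost every point to lie in infinitely many events. -/
theorem measure_infinite_eq_one_of_correlation_le {Ω : Type*} [MeasurableSpace Ω] (μ : Measure Ω)
    [IsProbabilityMeasure μ] {E : ℕ → Set Ω} (hE : ∀ n, MeasurableSet (E n))
    (hsum : ¬ Summable fun n => μ.real (E n)) {c : ℕ → ℝ} (hc0 : ∀ n, 0 ≤ c n) (hc : Summable c)
    (hcorr : ∀ m n, m < n → μ.real (E m ∩ E n) ≤ μ.real (E n) * (μ.real (E m) + c (n - m))) :
    μ {x | {n | x ∈ E n}.Infinite} = 1 := by
  set a : ℕ → ℝ := fun n => μ.real (E n)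
  have ha0 (n : ℕ) : 0 ≤ a n := measureReal_nonneg
  set X : ℕ → Ω → ℝ := fun n => (E n).indicator 1
  have hXint (n : ℕ) : Integrable (X n) μ := (integrable_const (1 : ℝ)).indicator (hE n)
  have hXmul (m n : ℕ) : (fun x => X m x * X n x) = (E m ∩ E n).indicator 1 := by
    funext x
    simp only [X, Set.inter_indicator_one, Pi.mul_apply]
  have hXXint (m n : ℕ) : Integrable (fun x => X m x * X n x) μ := by
    rw [hXmul]
    exact (integrable_const (1 : ℝ)).indicator ((hE m).inter (hE n))
  have hXI (n : ℕ) : ∫ x, X n x ∂μ = a n := integral_indicator_one (hE n)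
  have hXXI (m n : ℕ) : ∫ x, X m x * X n x ∂μ = μ.real (E m ∩ E n) := by
    rw [hXmul]
    exact integral_indicator_one ((hE m).inter (hE n))
  -- the counting function of the first `N` events and its mean
  set S : ℕ → Ω → ℝ := fun N x => ∑ n ∈ Finset.range N, X n x
  set Φ : ℕ → ℝ := fun N => ∑ n ∈ Finset.range N, a n
  have hSint (N : ℕ) : Integrable (S N) μ := integrable_finsetSum _ fun n _ => hXint n
  have hSI (N : ℕ) : ∫ x, S N x ∂μ = Φ N := by
    rw [integral_finsetSum _ fun n _ => hXint n]
    exact Finset.sum_congr rfl fun n _ => hXI n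
  have hsq (N : ℕ) (x : Ω) :
      S N x ^ 2 = ∑ m ∈ Finset.range N, ∑ n ∈ Finset.range N, X m x * X n x := by
    rw [pow_two, Finset.sum_mul_sum]
  have hSSint (N : ℕ) : Integrable (fun x => S N x ^ 2) μ := by
    simp_rw [hsq]
    exact integrable_finsetSum _ fun m _ => integrable_finsetSum _ fun n _ => hXXint m n
  set K : ℝ := 1 + 2 * ∑' n, c n
  have hK0 : 0 ≤ K := by
    have : 0 ≤ ∑' n, c n := tsum_nonneg hc0
    positivity
  have hΦstep (N : ℕ) : Φ (N + 1) = Φ N + a N := Finset.sum_range_succ _ _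
  have hsecond (N : ℕ) : ∫ x, S N x ^ 2 ∂μ ≤ Φ N ^ 2 + K * Φ N := by
    induction N with
    | zero => simp [S, Φ]
    | succ N ih =>
      have hcross : ∫ x, S N x * X N x ∂μ ≤ a N * (Φ N + ∑' n, c n) := by
        simp only [S, Finset.sum_mul]
        rw [integral_finsetSum _ fun n _ => hXXint n N]
        simp_rw [hXXI]
        calc ∑ m ∈ Finset.range N, μ.real (E m ∩ E N)
            ≤ ∑ m ∈ Finset.range N, a N * (a m + c (N - m)) :=
              Finset.sum_le_sum fun m hm => hcorr m N (Finset.mem_range.1 hm)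
          _ = a N * (Φ N + ∑ m ∈ Finset.range N, c (N - m)) := by
              rw [← Finset.mul_sum, Finset.sum_add_distrib]
          _ ≤ a N * (Φ N + ∑' n, c n) := by
              have hrefl : ∑ m ∈ Finset.range N, c (N - m) = ∑ m ∈ Finset.range N, c (m + 1) := by
                rw [← Finset.sum_range_reflect (fun m => c (m + 1))]
                refine Finset.sum_congr rfl fun m hm => congrArg c ?_
                have := Finset.mem_range.1 hm
                omega
              have hle : ∑ m ∈ Finset.range N, c (m + 1) ≤ ∑' n, c n := by
                have h1 := hc.sum_le_tsum (Finset.range (N + 1)) fun n _ => hc0 n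
                rw [Finset.sum_range_succ'] at h1
                linarith [hc0 0]
              rw [hrefl]
              exact mul_le_mul_of_nonneg_left (by linarith) (ha0 N)
      have hSX : Integrable (fun x => S N x * X N x) μ := by
        simp only [S, Finset.sum_mul]
        exact integrable_finsetSum _ fun n _ => hXXint n N
      have hexp : (fun x => S (N + 1) x ^ 2) =
          fun x => S N x ^ 2 + (2 * (S N x * X N x) + X N x * X N x) := by
        funext x
        have : S (N + 1) x = S N x + X N x := Finset.sum_range_succ _ _
        rw [this]
        ring
      have hrest : Integrable (fun x => 2 * (S N x * X N x) + X N x * X N x) μ :=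
        (hSX.const_mul 2).add (hXXint N N)
      rw [hexp, integral_add (hSSint N) hrest,
        integral_add (hSX.const_mul 2) (hXXint N N), integral_const_mul, hXXI, Set.inter_self,
        hΦstep]
      change _ + (_ + a N) ≤ _
      have : 0 ≤ a N ^ 2 := sq_nonneg _
      simp only [K] at ih ⊢
      nlinarith
  have hexp (N : ℕ) : (fun x => (S N x - Φ N) ^ 2) =
      fun x => S N x ^ 2 + (-(2 * Φ N) * S N x + Φ N ^ 2) := by
    funext x
    ring
  have hrest (N : ℕ) : Integrable (fun x => -(2 * Φ N) * S N x + Φ N ^ 2) μ :=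
    ((hSint N).const_mul _).add (integrable_const _)
  have hvint (N : ℕ) : Integrable (fun x => (S N x - Φ N) ^ 2) μ := by
    rw [hexp]
    exact (hSSint N).add (hrest N)
  have hvar (N : ℕ) : ∫ x, (S N x - Φ N) ^ 2 ∂μ ≤ K * Φ N := by
    rw [hexp, integral_add (hSSint N) (hrest N),
      integral_add ((hSint N).const_mul _) (integrable_const _), integral_const_mul, hSI]
    simp only [integral_const, probReal_univ, one_smul]
    nlinarith [hsecond N]
  have hΦ : Filter.Tendsto Φ Filter.atTop Filter.atTop :=
    (not_summable_iff_tendsto_nat_atTop_of_nonneg ha0).1 hsum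
  -- Chebyshev: the event `S N ≤ L` forces a deviation of at least `Φ N / 2` once `2 L < Φ N`
  have hnull (L : ℕ) : μ.real {x | ∀ N, S N x ≤ L} = 0 := by
    have hlim : Filter.Tendsto (fun N => 4 * K / Φ N) Filter.atTop (nhds 0) :=
      hΦ.const_div_atTop (4 * K)
    refine le_antisymm (ge_of_tendsto hlim ?_) measureReal_nonneg
    filter_upwards [hΦ.eventually_gt_atTop (2 * L)] with N hN
    have hL : (0 : ℝ) ≤ L := L.cast_nonneg
    have hΦ0 : 0 < Φ N := by linarith
    have hsub : {x | ∀ N, S N x ≤ L} ⊆ {x | (Φ N / 2) ^ 2 ≤ (S N x - Φ N) ^ 2} := by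
      intro x hx
      have hxN : S N x ≤ L := hx N
      change (Φ N / 2) ^ 2 ≤ (S N x - Φ N) ^ 2
      nlinarith
    have hcheb := mul_meas_ge_le_integral_of_nonneg (μ := μ)
      (Filter.Eventually.of_forall fun x => sq_nonneg (S N x - Φ N)) (hvint N) ((Φ N / 2) ^ 2)
    have h1 : (Φ N / 2) ^ 2 * μ.real {x | ∀ N, S N x ≤ L} ≤ K * Φ N :=
      (mul_le_mul_of_nonneg_left (measureReal_mono hsub) (sq_nonneg _)).trans
        (hcheb.trans (hvar N))
    rw [le_div_iff₀ hΦ0]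
    have h2 : Φ N * (μ.real {x | ∀ N, S N x ≤ L} * Φ N) ≤ Φ N * (4 * K) := by linarith
    exact le_of_mul_le_mul_left h2 hΦ0
  have hae : ∀ᵐ x ∂μ, {n | x ∈ E n}.Infinite := by
    have hall : ∀ᵐ x ∂μ, ∀ L : ℕ, ¬ ∀ N, S N x ≤ L := by
      refine ae_all_iff.2 fun L => ?_
      rw [ae_iff]
      simpa only [not_not] using (measureReal_eq_zero_iff).1 (hnull L)
    filter_upwards [hall] with x hx hfin
    refine hx hfin.toFinset.card fun N => ?_
    calc S N x = ∑ n ∈ Finset.range N with x ∈ E n, (1 : ℝ) := by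
          rw [Finset.sum_filter]
          simp only [S, X, Set.indicator_apply, Pi.one_apply]
      _ ≤ ∑ n ∈ hfin.toFinset, (1 : ℝ) :=
          Finset.sum_le_sum_of_subset_of_nonneg (fun n hn => by simpa using (Finset.mem_filter.1 hn).2)
            fun _ _ _ => zero_le_one
      _ = hfin.toFinset.card := by simp
  exact (measure_eq_measure_of_null_sdiff (Set.subset_univ _) (by
    rw [← Set.compl_eq_univ_sdiff]; exact hae)).trans measure_univ

/-! ### Return times -/

theorem norm_sub_lt_of_mem_torusBall {d : ℕ} {x y : UnitAddTorus (Fin d)} {r : ℝ}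
    (h : y ∈ torusBall x r) : ‖y - x‖ < r := by
  refine lt_of_le_of_lt ((pi_norm_le_iff_of_nonneg (Real.sqrt_nonneg _)).2 fun i => ?_) h
  exact Real.le_sqrt_of_sq_le (Finset.single_le_sum (f := fun i => ‖y i - x i‖ ^ 2)
    (fun _ _ => sq_nonneg _) (Finset.mem_univ i))

theorem mem_torusBall_of_norm_sub_lt {d : ℕ} (hd : 1 ≤ d) {x y : UnitAddTorus (Fin d)} {r : ℝ}
    (h : ‖y - x‖ < r / d) : y ∈ torusBall x r := by
  have hd1 : (1 : ℝ) ≤ d := by exact_mod_cast hd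
  have hle : torusDist y x ≤ d * ‖y - x‖ := by
    refine Real.sqrt_le_iff.2 ⟨by positivity, ?_⟩
    calc ∑ i, ‖y i - x i‖ ^ 2 ≤ ∑ _i : Fin d, ‖y - x‖ ^ 2 :=
          Finset.sum_le_sum fun i _ =>
            pow_le_pow_left₀ (norm_nonneg _) (norm_le_pi_norm (y - x) i) 2
      _ = d * ‖y - x‖ ^ 2 := by simp
      _ ≤ (d * ‖y - x‖) ^ 2 := by
          rw [mul_pow]
          exact mul_le_mul_of_nonneg_right (le_self_pow₀ hd1 two_ne_zero) (sq_nonneg _)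
  have hlt := (lt_div_iff₀' (by linarith)).1 h
  exact hle.trans_lt hlt

theorem pow_sub_pow_le_mul_sub {a b : ℝ} (ha : 0 ≤ a) (hab : a ≤ b) (hb : b ≤ 1) (k : ℕ) :
    b ^ k - a ^ k ≤ k * (b - a) := by
  induction k with
  | zero => simp
  | succ k ih =>
    have h0 : 0 ≤ b ^ k - a ^ k := sub_nonneg.2 (pow_le_pow_left₀ ha hab k)
    have h1 : b * (b ^ k - a ^ k) ≤ k * (b - a) := (mul_le_of_le_one_left h0 hb).trans ih
    have h2 : a ^ k * (b - a) ≤ b - a :=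
      mul_le_of_le_one_left (sub_nonneg.2 hab) (pow_le_one₀ ha (hab.trans hb))
    push_cast
    linarith [show b ^ (k + 1) - a ^ (k + 1) = b * (b ^ k - a ^ k) + a ^ k * (b - a) by ring]

/-- The volume of a cube in the torus is a Lipschitz function of its side. This keeps the constant
in front of the main term of the correlations equal to `1`, as the second moment method needs. -/
theorem min_one_add_pow_le {s δ : ℝ} (hs : 0 ≤ s) (hδ : 0 ≤ δ) (d : ℕ) :
    min 1 (2 * (s + δ)) ^ d ≤ min 1 (2 * s) ^ d + 2 * d * δ := by
  have h := pow_sub_pow_le_mul_sub (a := min 1 (2 * s)) (b := min 1 (2 * (s + δ)))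
    (le_min zero_le_one (by positivity)) (min_le_min_left _ (by linarith)) (min_le_left _ _) d
  have h1 : min 1 (2 * (s + δ)) - min 1 (2 * s) ≤ 2 * δ := by
    rcases le_total 1 (2 * s) with h2 | h2
    · rw [min_eq_left h2]
      linarith [min_le_left 1 (2 * (s + δ))]
    · rw [min_eq_right h2]
      linarith [min_le_right 1 (2 * (s + δ))]
  have h2 := mul_le_mul_of_nonneg_left h1 (Nat.cast_nonneg (α := ℝ) d)
  linarith

/-- Truncation at `1` does not affect divergence: if the truncated series converges, its terms are
eventually less than `1`, so the truncation is eventually inactive. -/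
theorem not_summable_min_one_mul_pow {d : ℕ} {u : ℕ → ℝ} (hu : ∀ n, 0 ≤ u n)
    {c : ℝ} (hc : 0 < c) (h : ¬ Summable fun n => u n ^ d) :
    ¬ Summable fun n => min 1 (c * u n) ^ d := by
  intro hs
  refine h (Summable.of_norm_bounded_eventually_nat (hs.mul_left ((c ^ d)⁻¹)) ?_)
  filter_upwards [hs.tendsto_atTop_zero.eventually_lt_const one_pos] with n hn
  have hlt : c * u n < 1 := by
    by_contra! hle
    simp [min_eq_left hle] at hn
  rw [min_eq_right hlt.le, Real.norm_of_nonneg (pow_nonneg (hu n) d), mul_pow,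
    inv_mul_cancel_left₀ (by positivity)]

theorem infinite_setOf_one_le_and_iff (p : ℕ → Prop) :
    {n | 1 ≤ n ∧ p n}.Infinite ↔ {k | p (k + 1)}.Infinite := by
  have h : {n | 1 ≤ n ∧ p n} = Nat.succ '' {k | p (k + 1)} := by
    ext n
    cases n <;> simp
  rw [h, Set.infinite_image_iff Nat.succ_injective.injOn]

/-- The convergence half, from the first Borel–Cantelli lemma: the set of `x` with
`Tⁿ x ∈ B(x, rₙ)` has measure at most `(2 rₙ)ᵈ`. -/
theorem volume_returnsInfinitelyOften_eq_zero {d : ℕ} (hd : 1 ≤ d) {A : Matrix (Fin d) (Fin d) ℤ}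
    (hdet : ∀ n, 1 ≤ n → (A ^ n - 1).det ≠ 0) {r : ℕ → ℝ} (hr : ∀ n : ℕ, 1 ≤ n → 0 ≤ r n)
    (hs : Summable fun n : ℕ => r (n + 1) ^ d) :
    volume (returnsInfinitelyOften (torusEndo A) r) = 0 := by
  have hset : returnsInfinitelyOften (torusEndo A) r =
      {x | ∃ᶠ k in Filter.atTop, (torusEndo A)^[k + 1] x ∈ torusBall x (r (k + 1))} := by
    ext x
    simp only [returnsInfinitelyOften, Set.mem_ofPred_eq, Nat.frequently_atTop_iff_infinite]
    exact infinite_setOf_one_le_and_iff fun n => (torusEndo A)^[n] x ∈ torusBall x (r n)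
  rw [hset]
  refine measure_setOfPred_frequently_eq_zero
    (ne_top_of_le_ne_top (hs.mul_left (2 ^ d)).tsum_ofReal_ne_top (ENNReal.tsum_le_tsum fun k => ?_))
  have hk : 1 ≤ k + 1 := Nat.le_add_left 1 k
  calc volume {x | (torusEndo A)^[k + 1] x ∈ torusBall x (r (k + 1))}
      ≤ volume (torusEndo (A ^ (k + 1) - 1) ⁻¹' Metric.ball 0 (r (k + 1))) := by
        refine measure_mono fun x hx => ?_
        rw [Set.mem_preimage, mem_ball_zero_iff, ← torusEndo_iterate_sub]
        exact norm_sub_lt_of_mem_torusBall hx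
    _ = ENNReal.ofReal (min 1 (2 * r (k + 1)) ^ d) := by
        rw [(measurePreserving_torusEndo (hdet _ hk)).measure_preimage
          Metric.isOpen_ball.nullMeasurableSet, volume_ball_unitAddTorus hd _ (hr _ hk)]
    _ ≤ ENNReal.ofReal (2 ^ d * r (k + 1) ^ d) := by
        have h2 : 0 ≤ 2 * r (k + 1) := mul_nonneg zero_le_two (hr _ hk)
        rw [← mul_pow]
        exact ENNReal.ofReal_le_ofReal
          (pow_le_pow_left₀ (le_min zero_le_one h2) (min_le_right _ _) d)

/-- The divergence half, for the inscribed cubes in place of the balls. -/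
theorem volume_returnsInfinitelyOften_eq_one {d : ℕ} (hd : 1 ≤ d) {A : Matrix (Fin d) (Fin d) ℤ}
    (hA : ∀ z : ℂ, IsComplexEigenvalue A z → 1 < ‖z‖)
    (hdet : ∀ n, 1 ≤ n → (A ^ n - 1).det ≠ 0) {r : ℕ → ℝ} (hr : ∀ n : ℕ, 1 ≤ n → 0 ≤ r n)
    (hs : ¬ Summable fun n : ℕ => r (n + 1) ^ d) :
    volume (returnsInfinitelyOften (torusEndo A) r) = 1 := by
  have hd0 : (0 : ℝ) < d := by exact_mod_cast hd
  have hdet' (k : ℕ) := hdet (k + 1) (Nat.le_add_left 1 k)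
  have hr' (k : ℕ) : 0 ≤ r (k + 1) := hr _ (Nat.le_add_left 1 k)
  have hs0 (k : ℕ) : 0 ≤ r (k + 1) / d := div_nonneg (hr' k) hd0.le
  obtain ⟨δ, hδ0, hδ, hbound⟩ := exists_summable_bound_pow_sub_one_mul_inv hd hA
  -- the cube of half-side `r / d` lies in the Euclidean ball of radius `r`, and is empty for `r = 0`
  set E : ℕ → Set (UnitAddTorus (Fin d)) := fun k =>
    torusEndo (A ^ (k + 1) - 1) ⁻¹' Metric.ball 0 (r (k + 1) / d)
  have hreal {s : ℝ} (h : 0 ≤ s) : volume.real (Metric.ball (0 : UnitAddTorus (Fin d)) s) =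
      min 1 (2 * s) ^ d := by
    rw [Measure.real, volume_ball_unitAddTorus hd _ h,
      ENNReal.toReal_ofReal (pow_nonneg (le_min zero_le_one (by positivity)) d)]
  have hEreal (k : ℕ) : volume.real (E k) = min 1 (2 * (r (k + 1) / d)) ^ d := by
    rw [← hreal (hs0 k), Measure.real, Measure.real, (measurePreserving_torusEndo
      (hdet' k)).measure_preimage Metric.isOpen_ball.nullMeasurableSet]
  have hone := measure_infinite_eq_one_of_correlation_le volume (E := E)
    (c := fun k => 2 * d * δ k)
    (fun k => (continuous_torusEndo _).measurable Metric.isOpen_ball.measurableSet) ?_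
    (fun k => mul_nonneg (by positivity) (hδ0 k)) (hδ.mul_left _) ?_
  · refine le_antisymm prob_le_one (hone.ge.trans (measure_mono fun x hx => ?_))
    refine (infinite_setOf_one_le_and_iff fun n => (torusEndo A)^[n] x ∈ torusBall x (r n)).2
      (Set.Infinite.mono (fun k hk => ?_) hx)
    refine mem_torusBall_of_norm_sub_lt hd ?_
    rw [torusEndo_iterate_sub]
    exact mem_ball_zero_iff.1 hk
  · have h := not_summable_min_one_mul_pow hr' (c := 2 / d) (by positivity) hs
    simp_rw [hEreal]
    convert h using 5
    ring
  · intro m n hmn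
    have hcor := volume_inter_preimage_ball_le (hdet' m) (hdet' n) (hδ0 (n - m))
      (by simpa using hbound (m + 1) (n + 1) (by omega) (hdet' n))
      (r (m + 1) / d) (r (n + 1) / d)
    have hcor' := ENNReal.toReal_mono (ENNReal.mul_ne_top (measure_ne_top _ _)
      (measure_ne_top _ _)) hcor
    rw [ENNReal.toReal_mul] at hcor'
    change volume.real (E m ∩ E n) ≤ volume.real _ * volume.real _ at hcor'
    rw [hreal (add_nonneg (hs0 m) (hδ0 _)), hreal (hs0 n), mul_comm] at hcor'
    rw [hEreal, hEreal]
    exact hcor'.trans (mul_le_mul_of_nonneg_left (min_one_add_pow_le (hs0 m) (hδ0 _) d)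
      (pow_nonneg (le_min zero_le_one (mul_nonneg zero_le_two (hs0 n))) d))

theorem theoremC (d : ℕ) (hd : 1 ≤ d) (A : Matrix (Fin d) (Fin d) ℤ)
    (hA : ∀ z : ℂ, IsComplexEigenvalue A z → ∀ n : ℕ, 1 ≤ n → z ^ n ≠ 1)
    (r : ℕ → ℝ) (hr : ∀ n : ℕ, 1 ≤ n → 0 ≤ r n) :
    ((Summable fun n : ℕ => r (n + 1) ^ d) →
      volume (returnsInfinitelyOften (torusEndo A) r) = 0) ∧
    ((∀ z : ℂ, IsComplexEigenvalue A z → 1 < ‖z‖) →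
      (¬ Summable fun n : ℕ => r (n + 1) ^ d) →
        volume (returnsInfinitelyOften (torusEndo A) r) = 1) := by
  have hdet (n : ℕ) (hn : 1 ≤ n) : (A ^ n - 1).det ≠ 0 :=
    det_pow_sub_one_ne_zero hn fun z hz => hA z hz n hn
  exact ⟨volume_returnsInfinitelyOften_eq_zero hd hdet hr,
    fun hexp => volume_returnsInfinitelyOften_eq_one hd hexp hdet hr⟩
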